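/- Let $\mathcal H_1,\mathcal H_2$ be complex Hilbert spaces, let $\mathcal H_1\otimes\mathcal H_2$ be their Hilbert space tensor product, and let $\rho$ be a normal state on $\mathcal B(\mathcal H_2)$, i.e. a positive linear functional with $\rho(\mathbb 1)=1$ that is continuous for the $\sigma$-weak operator topology. For $x\in\mathcal H_1$ let $V_x:\mathcal H_2\to\mathcal H_1\otimes\mathcal H_2$, $V_xu=x\otimes u$. Let $\mathbb E_\rho=\mathrm{id}\otimes\rho:\mathcal B(\mathcal H_1\otimes\mathcal H_2)\to\mathcal B(\mathcal H_1)$ be the slice map, i.e. the linear map with $\langle x,\mathbb E_\rho(A)y\rangle=\rho(V_x^*AV_y)$ for all $A\in\mathcal B(\mathcal H_1\otimes\mathcal H_2)$ and $x,y\in\mathcal H_1$. Then: 1. $\mathbb E_\rho(A\otimes B)=\rho(B)A$ for all $A\in\mathcal B(\mathcal H_1)$, $B\in\mathcal B(\mathcal H_2)$; the map $\mathbb E_\rho$ is continuous for the $\sigma$-weak operator topologies, and it is the only $\sigma$-weakly continuous linear map $\mathcal B(\mathcal H_1\otimes\mathcal H_2)\to\mathcal B(\mathcal H_1)$ that satisfies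 this identity. On every norm-bounded subset of $\mathcal B(\mathcal H_1\otimes\mathcal H_2)$, $\mathbb E_\rho$ is continuous for the weak operator topologies. 2. $\mathbb E_\rho(A\otimes\mathbb 1)=A$ for all $A\in\mathcal B(\mathcal H_1)$. 3. $\mathbb E_\rho\bigl((C\otimes\mathbb 1)A(D\otimes\mathbb 1)\bigr)=C\,\mathbb E_\rho(A)\,D$ for all $C,D\in\mathcal B(\mathcal H_1)$ and $A\in\mathcal B(\mathcal H_1\otimes\mathcal H_2)$. 4. Whenever $\epsilon\ge 0$ and $A\in\mathcal B(\mathcal H_1\otimes\mathcal H_2)$ satisfy $\|[A,\mathbb 1\otimes B]\|\le\epsilon\|A\|\|B\|$ for all $B\in\mathcal B(\mathcal H_2)$, one has $\|\mathbb E_\rho(A)\otimes\mathbb 1-A\|\le 2\epsilon\|A\|$. -/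

import Mathlib

open scoped TensorProduct ComplexOrder

noncomputable section

/-- The Hilbert space tensor product: the completion of the algebraic tensor product for the inner
product with `⟪x ⊗ₜ u, y ⊗ₜ v⟫ = ⟪x, y⟫ * ⟪u, v⟫`. -/
abbrev HilbertTensor (H₁ H₂ : Type*)
    [NormedAddCommGroup H₁] [InnerProductSpace ℂ H₁]
    [NormedAddCommGroup H₂] [InnerProductSpace ℂ H₂] : Type _ :=
  UniformSpace.Completion (H₁ ⊗[ℂ] H₂)

section

variable {H₁ H₂ : Type*}
  [NormedAddCommGroup H₁] [InnerProductSpace ℂ H₁]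
  [NormedAddCommGroup H₂] [InnerProductSpace ℂ H₂]

/-- The operator `A ⊗ B` on the Hilbert space tensor product: the continuous extension of
`x ⊗ₜ u ↦ A x ⊗ₜ B u`. -/
def opTensor (A : H₁ →L[ℂ] H₁) (B : H₂ →L[ℂ] H₂) :
    HilbertTensor H₁ H₂ →L[ℂ] HilbertTensor H₁ H₂ :=
  (TensorProduct.mapL A B).completion

/-- The bounded operator `V x : H₂ → H₁ ⊗ H₂`, `V x u = x ⊗ u`. -/
def ket (x : H₁) : H₂ →L[ℂ] HilbertTensor H₁ H₂ :=
  UniformSpace.Completion.toComplL.comp (TensorProduct.mkL ℂ H₁ H₂ x)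

theorem ket_apply (x : H₁) (u : H₂) :
    ket x u = ((x ⊗ₜ[ℂ] u : H₁ ⊗[ℂ] H₂) : HilbertTensor H₁ H₂) := rfl

theorem ket_add (x y : H₁) : ket (H₂ := H₂) (x + y) = ket x + ket y := by
  simp [ket, ContinuousLinearMap.comp_add]

theorem ket_smul (c : ℂ) (x : H₁) : ket (H₂ := H₂) (c • x) = c • ket x := by
  simp [ket]

theorem norm_ket_le (x : H₁) : ‖ket (H₂ := H₂) x‖ ≤ ‖x‖ :=
  ContinuousLinearMap.opNorm_le_bound _ (norm_nonneg x) fun u => by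
    rw [ket_apply, UniformSpace.Completion.norm_coe, TensorProduct.norm_tmul]

theorem opTensor_ket (A : H₁ →L[ℂ] H₁) (B : H₂ →L[ℂ] H₂) (x : H₁) (u : H₂) :
    opTensor A B (ket x u) = ket (A x) (B u) := by
  simp [opTensor, ket_apply]

variable [CompleteSpace H₂]

/-- The operator `(V x)* A (V y)` on `H₂`. -/
def compress (A : HilbertTensor H₁ H₂ →L[ℂ] HilbertTensor H₁ H₂) (x y : H₁) : H₂ →L[ℂ] H₂ :=
  (ContinuousLinearMap.adjoint (ket (H₂ := H₂) x)).comp (A.comp (ket y))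

theorem inner_compress (A : HilbertTensor H₁ H₂ →L[ℂ] HilbertTensor H₁ H₂) (x y : H₁) (u v : H₂) :
    inner ℂ u (compress A x y v) = inner ℂ (ket x u) (A (ket y v)) := by
  simp [compress, ContinuousLinearMap.adjoint_inner_right]

/-- The bounded sesquilinear form `(x, y) ↦ ρ ((V x)* A (V y))`. -/
def sliceForm (ρ : (H₂ →L[ℂ] H₂) →L[ℂ] ℂ)
    (A : HilbertTensor H₁ H₂ →L[ℂ] HilbertTensor H₁ H₂) : H₁ →L⋆[ℂ] H₁ →L[ℂ] ℂ :=
  LinearMap.mkContinuous₂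
    (LinearMap.mk₂'ₛₗ (starRingEnd ℂ) (RingHom.id ℂ) (fun x y => ρ (compress A x y))
      (by intro x x' y; simp [compress, ket_add, ContinuousLinearMap.add_comp])
      (by
        intro c x y
        simp [compress, ket_smul, map_smulₛₗ])
      (by intro x y y'; simp [compress, ket_add, ContinuousLinearMap.comp_add])
      (by intro c x y; simp [compress, ket_smul]))
    (‖ρ‖ * ‖A‖)
    (by
      intro x y
      have h1 : ‖ContinuousLinearMap.adjoint (ket (H₂ := H₂) x)‖ ≤ ‖x‖ := by
        rw [LinearIsometryEquiv.norm_map]; exact norm_ket_le x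
      have h2 : ‖ket (H₂ := H₂) y‖ ≤ ‖y‖ := norm_ket_le y
      calc ‖ρ (compress A x y)‖
          ≤ ‖ρ‖ * (‖ContinuousLinearMap.adjoint (ket (H₂ := H₂) x)‖ *
              (‖A‖ * ‖ket (H₂ := H₂) y‖)) := by
            refine (ρ.le_opNorm _).trans ?_
            gcongr
            refine (ContinuousLinearMap.opNorm_comp_le _ _).trans ?_
            gcongr
            exact ContinuousLinearMap.opNorm_comp_le _ _
        _ ≤ ‖ρ‖ * (‖x‖ * (‖A‖ * ‖y‖)) := by gcongr
        _ = _ := by ring)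

theorem sliceForm_apply (ρ : (H₂ →L[ℂ] H₂) →L[ℂ] ℂ)
    (A : HilbertTensor H₁ H₂ →L[ℂ] HilbertTensor H₁ H₂) (x y : H₁) :
    sliceForm ρ A x y = ρ (compress A x y) := rfl

variable [CompleteSpace H₁]

/-- The bounded operator `id ⊗ ρ` applied to `A`: the operator `T` on `H₁` with
`⟪x, T y⟫ = ρ ((V x)* A (V y))` for all `x` and `y`, see `inner_sliceOp`. -/
def sliceOp (ρ : (H₂ →L[ℂ] H₂) →L[ℂ] ℂ)
    (A : HilbertTensor H₁ H₂ →L[ℂ] HilbertTensor H₁ H₂) : H₁ →L[ℂ] H₁ :=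
  ContinuousLinearMap.adjoint (InnerProductSpace.continuousLinearMapOfBilin (sliceForm ρ A))

theorem inner_sliceOp (ρ : (H₂ →L[ℂ] H₂) →L[ℂ] ℂ)
    (A : HilbertTensor H₁ H₂ →L[ℂ] HilbertTensor H₁ H₂) (x y : H₁) :
    inner ℂ x (sliceOp ρ A y) = ρ (compress A x y) := by
  rw [sliceOp, ContinuousLinearMap.adjoint_inner_right,
    InnerProductSpace.continuousLinearMapOfBilin_apply, sliceForm_apply]

/-- The slice map `E_ρ = id ⊗ ρ : B(H₁ ⊗ H₂) → B(H₁)` of a bounded functional `ρ` on `B(H₂)`. -/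
def sliceMap (ρ : (H₂ →L[ℂ] H₂) →L[ℂ] ℂ) :
    (HilbertTensor H₁ H₂ →L[ℂ] HilbertTensor H₁ H₂) →ₗ[ℂ] (H₁ →L[ℂ] H₁) where
  toFun := sliceOp ρ
  map_add' A A' := by
    ext y
    refine ext_inner_left ℂ fun x => ?_
    simp [inner_add_right, inner_sliceOp, compress, ContinuousLinearMap.add_comp,
      ContinuousLinearMap.comp_add]
  map_smul' c A := by
    ext y
    refine ext_inner_left ℂ fun x => ?_
    simp [inner_smul_right, inner_sliceOp, compress, ContinuousLinearMap.smul_comp]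

theorem inner_sliceMap (ρ : (H₂ →L[ℂ] H₂) →L[ℂ] ℂ)
    (A : HilbertTensor H₁ H₂ →L[ℂ] HilbertTensor H₁ H₂) (x y : H₁) :
    inner ℂ x (sliceMap ρ A y) = ρ (compress A x y) := inner_sliceOp ρ A x y

end

/-- The `σ`-weak operator topology on `B(H)`: the coarsest topology for which all functionals
`A ↦ ∑ₙ ⟪xₙ, A yₙ⟫` with `∑ₙ ‖xₙ‖² < ∞` and `∑ₙ ‖yₙ‖² < ∞` are continuous. -/
@[reducible] def sigmaWeakTopology (H : Type*) [NormedAddCommGroup H] [InnerProductSpace ℂ H] :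
    TopologicalSpace (H →L[ℂ] H) :=
  ⨅ (x : ℕ → H) (y : ℕ → H) (_ : Summable fun n => ‖x n‖ ^ 2) (_ : Summable fun n => ‖y n‖ ^ 2),
    TopologicalSpace.induced (fun A : H →L[ℂ] H => ∑' n, inner ℂ (x n) (A (y n))) inferInstance

/-- A linear map `B(H) → B(K)` is normal if it is continuous for the `σ`-weak topologies. -/
def IsNormalMap {H K : Type*} [NormedAddCommGroup H] [InnerProductSpace ℂ H]
    [NormedAddCommGroup K] [InnerProductSpace ℂ K]
    (E : (H →L[ℂ] H) →ₗ[ℂ] (K →L[ℂ] K)) : Prop :=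
  @Continuous _ _ (sigmaWeakTopology H) (sigmaWeakTopology K) E

/-- A normal state on `B(H)`: a positive, normalized and `σ`-weakly continuous linear functional
(positive functionals on `B(H)` are automatically norm continuous). -/
structure IsNormalState {H : Type*} [NormedAddCommGroup H] [InnerProductSpace ℂ H]
    (ρ : (H →L[ℂ] H) →L[ℂ] ℂ) : Prop where
  nonneg : ∀ A : H →L[ℂ] H, A.IsPositive → 0 ≤ ρ A
  map_one : ρ 1 = 1
  normal : @Continuous _ _ (sigmaWeakTopology H) inferInstance ρ

end

/-! The σ-weakly continuous functionals on B(H) are exactly the finite linear combinations of the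
series A ↦ ∑ₙ ⟪xₙ, A yₙ⟫ (`continuous_sigmaWeak_iff`), so each fact about them needs checking on one
series only. The slice map is normal because the vectors xₙ ⊗ uₘ are again square summable
(`exists_hasSum_compress`). Uniqueness holds because a normal functional is determined by operators
of rank one (`hasSum_rankOne_of_mem_span`), and these are norm limits of sums of elementary tensors.

For the approximation bound write c = ε‖A‖. Let P be the projection onto a finite-dimensional
subspace of H₂. Signed shifts U of an orthonormal basis satisfy U*U = P, and the average of U*BU is
the normalized trace of B times P. Averaging (1 ⊗ U*)A(1 ⊗ U), each term within c of (1 ⊗ P)A, gives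
A' ⊗ P within c of (1 ⊗ P)A. Here A' depends on P. Slicing with ρ, a contraction with ρ(P) close to
1, shows that A' is within about c of E_ρ(A). Together these bound (1 ⊗ P)(E_ρ(A) ⊗ 1 - A) by about
2c, and P may be taken to fix any given algebraic tensor. -/

open Filter Topology

/-! ### Normal functionals as combinations of vector series -/

section SigmaWeak

variable {H : Type*} [NormedAddCommGroup H] [InnerProductSpace ℂ H]

theorem summable_norm_mul_norm {ι E F : Type*} [NormedAddCommGroup E] [NormedAddCommGroup F]
    {x : ι → E} {y : ι → F} (hx : Summable fun n => ‖x n‖ ^ 2)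
    (hy : Summable fun n => ‖y n‖ ^ 2) : Summable fun n => ‖x n‖ * ‖y n‖ :=
  Summable.of_nonneg_of_le (fun n => by positivity)
    (fun n => by nlinarith [sq_nonneg (‖x n‖ - ‖y n‖), sq_nonneg ‖x n‖, sq_nonneg ‖y n‖])
    (hx.add hy)

theorem norm_inner_apply_le (A : H →L[ℂ] H) (x y : H) :
    ‖inner ℂ x (A y)‖ ≤ ‖A‖ * (‖x‖ * ‖y‖) :=
  calc ‖inner ℂ x (A y)‖ ≤ ‖x‖ * (‖A‖ * ‖y‖) :=
        (norm_inner_le_norm _ _).trans (by gcongr; exact A.le_opNorm y)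
    _ = _ := by ring

theorem summable_inner_apply {ι : Type*} {x y : ι → H} (hx : Summable fun n => ‖x n‖ ^ 2)
    (hy : Summable fun n => ‖y n‖ ^ 2) (A : H →L[ℂ] H) :
    Summable fun n => inner ℂ (x n) (A (y n)) :=
  Summable.of_norm_bounded ((summable_norm_mul_norm hx hy).mul_left ‖A‖)
    fun _ => norm_inner_apply_le _ _ _

variable (H) in
/-- The square summable sequences of vectors. -/
abbrev SqSummable : Type _ := {x : ℕ → H // Summable fun n => ‖x n‖ ^ 2}

/-- The functional `A ↦ ∑ₙ ⟪xₙ, A yₙ⟫`. -/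
noncomputable def vectorFunctional (p : SqSummable H × SqSummable H) : (H →L[ℂ] H) →ₗ[ℂ] ℂ where
  toFun A := ∑' n, inner ℂ (p.1.1 n) (A (p.2.1 n))
  map_add' A B := by
    rw [← (summable_inner_apply p.1.2 p.2.2 A).tsum_add (summable_inner_apply p.1.2 p.2.2 B)]
    simp
  map_smul' c A := by
    simp [tsum_mul_left]

theorem hasSum_vectorFunctional (p : SqSummable H × SqSummable H) (A : H →L[ℂ] H) :
    HasSum (fun n => inner ℂ (p.1.1 n) (A (p.2.1 n))) (vectorFunctional p A) :=
  (summable_inner_apply p.1.2 p.2.2 A).hasSum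

theorem sigmaWeakTopology_eq_iInf : sigmaWeakTopology H =
    ⨅ p : SqSummable H × SqSummable H,
      TopologicalSpace.induced (vectorFunctional p) inferInstance := by
  apply le_antisymm
  · refine le_iInf fun p => ?_
    exact (iInf_le _ p.1.1).trans <| (iInf_le _ p.2.1).trans <| (iInf_le _ p.1.2).trans
      (iInf_le _ p.2.2)
  · refine le_iInf fun x => le_iInf fun y => le_iInf fun hx => le_iInf fun hy => ?_
    exact iInf_le (fun p : SqSummable H × SqSummable H =>
      TopologicalSpace.induced (vectorFunctional p) inferInstance) (⟨x, hx⟩, ⟨y, hy⟩)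

/-- A functional continuous for the topology induced by a family of functionals is bounded by
finitely many of them, hence lies in their span. This opens every later claim on normality to span
induction. -/
theorem continuous_sigmaWeak_iff (φ : (H →L[ℂ] H) →ₗ[ℂ] ℂ) :
    @Continuous _ _ (sigmaWeakTopology H) inferInstance φ ↔
      φ ∈ Submodule.span ℂ (Set.range (vectorFunctional (H := H))) := by
  rw [sigmaWeakTopology_eq_iInf, LinearMap.mem_span_iff_continuous]

theorem isNormalMap_iff {K : Type*} [NormedAddCommGroup K] [InnerProductSpace ℂ K]
    (E : (H →L[ℂ] H) →ₗ[ℂ] (K →L[ℂ] K)) :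
    IsNormalMap E ↔ ∀ p, vectorFunctional p ∘ₗ E ∈
      Submodule.span ℂ (Set.range (vectorFunctional (H := H))) := by
  simp only [← continuous_sigmaWeak_iff]
  rw [IsNormalMap, sigmaWeakTopology_eq_iInf (H := K), continuous_iInf_rng]
  simp only [continuous_induced_rng]
  rfl

/-- Needed for series over ℕ × ℕ, which arise when slicing. -/
theorem exists_mem_span_hasSum {ι : Type*} (e : ℕ ≃ ι) {x y : ι → H}
    (hx : Summable fun n => ‖x n‖ ^ 2) (hy : Summable fun n => ‖y n‖ ^ 2) :
    ∃ φ ∈ Submodule.span ℂ (Set.range (vectorFunctional (H := H))),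
      ∀ A, HasSum (fun i => inner ℂ (x i) (A (y i))) (φ A) :=
  ⟨_, Submodule.subset_span
    ⟨(⟨x ∘ e, e.summable_iff.2 hx⟩, ⟨y ∘ e, e.summable_iff.2 hy⟩), rfl⟩,
    fun A => e.hasSum_iff.1 (hasSum_vectorFunctional _ A)⟩

theorem summable_norm_sq_single {E : Type*} [NormedAddCommGroup E] (x : E) :
    Summable fun n => ‖(Pi.single 0 x : ℕ → E) n‖ ^ 2 :=
  summable_of_ne_finset_zero (s := {0}) fun n hn => by
    simp [Pi.single_eq_of_ne (show n ≠ 0 by simpa using hn)]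

theorem vectorFunctional_single (x y : H) (A : H →L[ℂ] H) :
    vectorFunctional (⟨_, summable_norm_sq_single x⟩, ⟨_, summable_norm_sq_single y⟩) A =
      inner ℂ x (A y) := by
  change ∑' n, inner ℂ ((Pi.single 0 x : ℕ → H) n) (A ((Pi.single 0 y : ℕ → H) n)) = _
  rw [tsum_eq_single 0 fun n hn => by simp [Pi.single_eq_of_ne hn]]
  simp

theorem exists_bound_of_mem_span {φ : (H →L[ℂ] H) →ₗ[ℂ] ℂ}
    (hφ : φ ∈ Submodule.span ℂ (Set.range (vectorFunctional (H := H)))) :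
    ∃ C, ∀ A, ‖φ A‖ ≤ C * ‖A‖ := by
  induction hφ using Submodule.span_induction with
  | mem φ h =>
    obtain ⟨p, rfl⟩ := h
    have hs := summable_norm_mul_norm p.1.2 p.2.2
    refine ⟨∑' n, ‖p.1.1 n‖ * ‖p.2.1 n‖, fun A => ?_⟩
    rw [mul_comm, ← tsum_mul_left]
    exact tsum_of_norm_bounded (hs.mul_left ‖A‖).hasSum fun n => norm_inner_apply_le _ _ _
  | zero => exact ⟨0, by simp⟩
  | add φ ψ _ _ h₁ h₂ =>
    obtain ⟨C, hC⟩ := h₁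
    obtain ⟨D, hD⟩ := h₂
    refine ⟨C + D, fun A => (norm_add_le _ _).trans ?_⟩
    rw [add_mul]
    exact add_le_add (hC A) (hD A)
  | smul c φ _ h =>
    obtain ⟨C, hC⟩ := h
    refine ⟨‖c‖ * C, fun A => ?_⟩
    rw [LinearMap.smul_apply, norm_smul, mul_assoc]
    exact mul_le_mul_of_nonneg_left (hC A) (norm_nonneg c)

/-- A normal functional is determined by its values on operators of rank one. -/
theorem hasSum_rankOne_of_mem_span [CompleteSpace H] {ι : Type*} (b : HilbertBasis ι ℂ H)
    {φ : (H →L[ℂ] H) →ₗ[ℂ] ℂ}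
    (hφ : φ ∈ Submodule.span ℂ (Set.range (vectorFunctional (H := H)))) (A : H →L[ℂ] H) :
    HasSum (fun i => φ (InnerProductSpace.rankOne ℂ (A (b i)) (b i))) (φ A) := by
  induction hφ using Submodule.span_induction with
  | mem φ h =>
    obtain ⟨⟨⟨x, hx⟩, ⟨y, hy⟩⟩, rfl⟩ := h
    -- Parseval in each `z n`: square summability passes to the double family of coefficients. With
    -- `A* x` and `y` this gives the absolute convergence that permits exchanging the two sums.
    have key (z : ℕ → H) (hz : Summable fun n => ‖z n‖ ^ 2) :
        Summable fun q : ℕ × ι => ‖inner ℂ (b q.2) (z q.1)‖ ^ 2 := by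
      have h n : HasSum (fun i => ‖inner ℂ (b i) (z n)‖ ^ 2) (‖z n‖ ^ 2) := by
        have := b.hasSum_inner_mul_inner (z n) (z n)
        rw [inner_self_eq_norm_sq_to_K] at this
        have := Complex.hasSum_re this
        convert this using 1
        · ext i
          rw [← inner_conj_symm (z n) (b i), RCLike.conj_mul]
          norm_cast
        · norm_cast
      rw [summable_prod_of_nonneg fun _ => by positivity]
      exact ⟨fun n => (h n).summable, by simpa only [(h _).tsum_eq] using hz⟩
    have hAx : Summable fun n => ‖(ContinuousLinearMap.adjoint A) (x n)‖ ^ 2 := by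
      refine Summable.of_nonneg_of_le (fun n => by positivity) (fun n => ?_)
        (hx.mul_left (‖ContinuousLinearMap.adjoint A‖ ^ 2))
      rw [← mul_pow]
      gcongr
      exact ContinuousLinearMap.le_opNorm _ _
    have hs : Summable fun q : ℕ × ι => inner ℂ (x q.1) (A (b q.2)) * inner ℂ (b q.2) (y q.1) := by
      refine Summable.of_norm_bounded (summable_norm_mul_norm (key _ hAx) (key _ hy)) fun q => ?_
      rw [norm_mul, ← ContinuousLinearMap.adjoint_inner_left, norm_inner_symm]
    have h₁ n : HasSum (fun i => inner ℂ (x n) (A (b i)) * inner ℂ (b i) (y n))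
        (inner ℂ (x n) (A (y n))) := by
      simpa only [ContinuousLinearMap.adjoint_inner_left] using
        b.hasSum_inner_mul_inner (ContinuousLinearMap.adjoint A (x n)) (y n)
    have h₂ := hs.hasSum.prod_fiberwise h₁
    have h₃ : HasSum (fun q : ι × ℕ => inner ℂ (x q.2) (A (b q.1)) * inner ℂ (b q.1) (y q.2))
        (vectorFunctional (⟨x, hx⟩, ⟨y, hy⟩) A) := by
      rw [(hasSum_vectorFunctional (⟨x, hx⟩, ⟨y, hy⟩) A).unique h₂]
      exact (Equiv.prodComm ι ℕ).hasSum_iff.2 hs.hasSum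
    refine h₃.prod_fiberwise fun i => ?_
    convert hasSum_vectorFunctional (⟨x, hx⟩, ⟨y, hy⟩) _ using 2 with n
    rw [InnerProductSpace.rankOne_apply, inner_smul_right, mul_comm]
  | zero => simp
  | add φ ψ _ _ h₁ h₂ => exact h₁.add h₂
  | smul c φ _ h => exact h.const_smul c

/-- On bounded sets, normal functionals are continuous for the weak operator topology. -/
theorem continuousOn_wot_of_mem_span [CompleteSpace H] {φ : (H →L[ℂ] H) →ₗ[ℂ] ℂ}
    (hφ : φ ∈ Submodule.span ℂ (Set.range (vectorFunctional (H := H)))) (r : ℝ) :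
    ContinuousOn (fun A : H →WOT[ℂ] H => φ A.toCLM) {A | ‖A.toCLM‖ ≤ r} := by
  induction hφ using Submodule.span_induction with
  | mem φ h =>
    obtain ⟨p, rfl⟩ := h
    -- Weierstrass test: the bound `r` makes the majorant independent of `A`.
    refine continuousOn_tsum (u := fun n => r * (‖p.1.1 n‖ * ‖p.2.1 n‖)) (fun n => ?_)
      ((summable_norm_mul_norm p.1.2 p.2.2).mul_left r) fun n A hA => ?_
    · exact (ContinuousLinearMapWOT.continuous_inner_apply continuous_id _ _).continuousOn
    · exact (norm_inner_apply_le _ _ _).trans (by gcongr; exact hA)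
  | zero => exact continuousOn_const
  | add φ ψ _ _ h₁ h₂ => exact h₁.add h₂
  | smul c φ _ h => exact h.const_smul c

end SigmaWeak

theorem norm_le_of_norm_inner_le {E : Type*} [NormedAddCommGroup E] [InnerProductSpace ℂ E]
    {T : E →L[ℂ] E} {C : ℝ} (hC : 0 ≤ C)
    (h : ∀ x y, ‖inner ℂ x (T y)‖ ≤ C * (‖x‖ * ‖y‖)) : ‖T‖ ≤ C := by
  refine T.opNorm_le_bound hC fun y => ?_
  rcases eq_or_ne (T y) 0 with h0 | h0
  · rw [h0, norm_zero]
    positivity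
  · have := h (T y) y
    rw [inner_self_eq_norm_sq_to_K, ← RCLike.ofReal_pow, RCLike.norm_of_nonneg (by positivity)]
      at this
    have hp := norm_pos_iff.2 h0
    nlinarith

/-! ### Compressions, normality of the slice map, uniqueness -/

section Slice

variable {H₁ H₂ : Type*}
  [NormedAddCommGroup H₁] [InnerProductSpace ℂ H₁]
  [NormedAddCommGroup H₂] [InnerProductSpace ℂ H₂]

theorem HilbertTensor.induction_on {p : HilbertTensor H₁ H₂ → Prop} (ζ : HilbertTensor H₁ H₂)
    (hc : IsClosed {ζ | p ζ}) (ket : ∀ x u, p (ket x u)) (add : ∀ ζ ζ', p ζ → p ζ' → p (ζ + ζ')) :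
    p ζ := by
  refine UniformSpace.Completion.induction_on ζ hc fun t => ?_
  induction t using TensorProduct.induction_on with
  | zero => simpa [ket_apply] using ket 0 0
  | tmul x u => exact ket x u
  | add s t hs ht =>
    rw [UniformSpace.Completion.coe_add]
    exact add _ _ hs ht

theorem inner_ket_ket (x y : H₁) (u v : H₂) :
    inner ℂ (ket x u) (ket y v) = inner ℂ x y * inner ℂ u v := by
  rw [ket_apply, ket_apply, UniformSpace.Completion.inner_coe, TensorProduct.inner_tmul]

theorem norm_ket_apply (x : H₁) (u : H₂) : ‖ket x u‖ = ‖x‖ * ‖u‖ := by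
  rw [ket_apply, UniformSpace.Completion.norm_coe, TensorProduct.norm_tmul]

theorem ket_add_left (x y : H₁) (u : H₂) : ket (x + y) u = ket x u + ket y u := by
  rw [ket_add, add_apply]

theorem HilbertTensor.hom_ext {S T : HilbertTensor H₁ H₂ →L[ℂ] HilbertTensor H₁ H₂}
    (h : ∀ x u, S (ket x u) = T (ket x u)) : S = T := by
  ext1 ζ
  refine HilbertTensor.induction_on (p := fun ζ => S ζ = T ζ) ζ
    (isClosed_eq S.continuous T.continuous) h fun ζ ζ' h₁ h₂ => ?_
  rw [map_add, map_add, h₁, h₂]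

theorem opTensor_mul (A C : H₁ →L[ℂ] H₁) (B D : H₂ →L[ℂ] H₂) :
    opTensor A B * opTensor C D = opTensor (A * C) (B * D) :=
  HilbertTensor.hom_ext fun x u => by simp [opTensor_ket]

theorem norm_opTensor_le (A : H₁ →L[ℂ] H₁) (B : H₂ →L[ℂ] H₂) :
    ‖opTensor A B‖ ≤ ‖A‖ * ‖B‖ := by
  refine ContinuousLinearMap.opNorm_le_bound _ (by positivity) fun ζ => ?_
  refine UniformSpace.Completion.induction_on ζ (isClosed_le (by fun_prop) (by fun_prop))
    fun t => ?_
  rw [opTensor, ContinuousLinearMap.completion_apply_coe, UniformSpace.Completion.norm_coe,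
    UniformSpace.Completion.norm_coe]
  exact ContinuousLinearMap.le_of_opNorm_le _ (TensorProduct.norm_mapL_le A B) t

theorem opTensor_sub_left (A C : H₁ →L[ℂ] H₁) (B : H₂ →L[ℂ] H₂) :
    opTensor (A - C) B = opTensor A B - opTensor C B :=
  HilbertTensor.hom_ext fun x u => by
    rw [sub_apply, opTensor_ket, opTensor_ket, opTensor_ket, eq_sub_iff_add_eq,
      ← ket_add_left, sub_apply, sub_add_cancel]

variable [CompleteSpace H₂]

section

variable [CompleteSpace H₁]

theorem adjoint_opTensor (A : H₁ →L[ℂ] H₁) (B : H₂ →L[ℂ] H₂) :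
    ContinuousLinearMap.adjoint (opTensor A B) =
      opTensor (ContinuousLinearMap.adjoint A) (ContinuousLinearMap.adjoint B) := by
  refine HilbertTensor.hom_ext fun x u => ext_inner_right ℂ fun ζ => ?_
  refine HilbertTensor.induction_on (p := fun ζ => inner ℂ _ ζ = inner ℂ _ ζ) ζ
    (isClosed_eq (by fun_prop) (by fun_prop)) (fun y v => ?_) fun ζ ζ' h₁ h₂ => ?_
  · simp [ContinuousLinearMap.adjoint_inner_left, opTensor_ket, inner_ket_ket]
  · rw [inner_add_right, inner_add_right, h₁, h₂]

/-- Follows from (D ⊗ G) V_y = V_{Dy} G and its adjoint. The case F = G = 1 gives the bimodule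
property; C = D = 1 transfers multiplication on the second factor to the compressions. -/
theorem compress_mul_mul (A : HilbertTensor H₁ H₂ →L[ℂ] HilbertTensor H₁ H₂)
    (C D : H₁ →L[ℂ] H₁) (F G : H₂ →L[ℂ] H₂) (x y : H₁) :
    compress (opTensor C F * A * opTensor D G) x y =
      F * compress A (ContinuousLinearMap.adjoint C x) (D y) * G := by
  ext v
  refine ext_inner_left ℂ fun u => ?_
  rw [inner_compress, mul_apply_eq_comp, mul_apply_eq_comp, opTensor_ket,
    ← ContinuousLinearMap.adjoint_inner_left (opTensor C F), adjoint_opTensor, opTensor_ket,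
    mul_apply_eq_comp, mul_apply_eq_comp,
    ← ContinuousLinearMap.adjoint_inner_left F, inner_compress]

end

theorem compress_opTensor (A : H₁ →L[ℂ] H₁) (B : H₂ →L[ℂ] H₂) (x y : H₁) :
    compress (opTensor A B) x y = inner ℂ x (A y) • B := by
  ext v
  refine ext_inner_left ℂ fun u => ?_
  rw [inner_compress, opTensor_ket, inner_ket_ket, smul_apply, inner_smul_right]

theorem norm_compress_le (A : HilbertTensor H₁ H₂ →L[ℂ] HilbertTensor H₁ H₂) (x y : H₁) :
    ‖compress A x y‖ ≤ ‖A‖ * (‖x‖ * ‖y‖) := by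
  calc ‖compress A x y‖
      ≤ ‖ContinuousLinearMap.adjoint (ket (H₂ := H₂) x)‖ * (‖A‖ * ‖ket (H₂ := H₂) y‖) :=
        (ContinuousLinearMap.opNorm_comp_le _ _).trans
          (by gcongr; exact ContinuousLinearMap.opNorm_comp_le _ _)
    _ ≤ ‖x‖ * (‖A‖ * ‖y‖) := by
        rw [LinearIsometryEquiv.norm_map]
        gcongr <;> exact norm_ket_le _
    _ = _ := by ring

variable [CompleteSpace H₁]

theorem norm_sliceMap_le_of_bound (ρ : (H₂ →L[ℂ] H₂) →L[ℂ] ℂ) {C : ℝ}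
    (hC : 0 ≤ C) (h : ∀ B, ‖ρ B‖ ≤ C * ‖B‖)
    (A : HilbertTensor H₁ H₂ →L[ℂ] HilbertTensor H₁ H₂) : ‖sliceMap ρ A‖ ≤ C * ‖A‖ := by
  refine norm_le_of_norm_inner_le (by positivity) fun x y => ?_
  rw [inner_sliceMap, mul_assoc]
  exact (h _).trans (by gcongr; exact norm_compress_le A x y)

theorem sliceMap_opTensor (ρ : (H₂ →L[ℂ] H₂) →L[ℂ] ℂ) (A : H₁ →L[ℂ] H₁) (B : H₂ →L[ℂ] H₂) :
    sliceMap ρ (opTensor A B) = ρ B • A := by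
  ext y
  refine ext_inner_left ℂ fun x => ?_
  rw [inner_sliceMap, compress_opTensor, map_smul, smul_apply, inner_smul_right,
    smul_eq_mul, mul_comm]

theorem sliceMap_bimodule (ρ : (H₂ →L[ℂ] H₂) →L[ℂ] ℂ) (C D : H₁ →L[ℂ] H₁)
    (A : HilbertTensor H₁ H₂ →L[ℂ] HilbertTensor H₁ H₂) :
    sliceMap ρ (opTensor C 1 * A * opTensor D 1) = C * sliceMap ρ A * D := by
  ext y
  refine ext_inner_left ℂ fun x => ?_
  rw [inner_sliceMap, compress_mul_mul, one_mul, mul_one, mul_apply_eq_comp,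
    mul_apply_eq_comp, ← ContinuousLinearMap.adjoint_inner_left, inner_sliceMap]

omit [CompleteSpace H₁] in
-- Since ‖x ⊗ u‖ = ‖x‖‖u‖, the vectors xₙ ⊗ uₘ are square summable over ℕ × ℕ; summing their series
-- over m first recovers the compressions.
theorem exists_hasSum_compress (p : SqSummable H₁ × SqSummable H₁) {φ : (H₂ →L[ℂ] H₂) →ₗ[ℂ] ℂ}
    (hφ : φ ∈ Submodule.span ℂ (Set.range (vectorFunctional (H := H₂)))) :
    ∃ ψ ∈ Submodule.span ℂ (Set.range (vectorFunctional (H := HilbertTensor H₁ H₂))),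
      ∀ A, HasSum (fun n => φ (compress A (p.1.1 n) (p.2.1 n))) (ψ A) := by
  induction hφ using Submodule.span_induction with
  | mem φ h =>
    obtain ⟨q, rfl⟩ := h
    have hs (a : SqSummable H₁) (b : SqSummable H₂) :
        Summable fun n : ℕ × ℕ => ‖ket (a.1 n.1) (b.1 n.2)‖ ^ 2 := by
      simp_rw [norm_ket_apply, mul_pow]
      exact a.2.mul_of_nonneg b.2 (fun _ => by positivity) (fun _ => by positivity)
    obtain ⟨ψ, hψ, h⟩ := exists_mem_span_hasSum Nat.pairEquiv.symm (hs p.1 q.1) (hs p.2 q.2)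
    refine ⟨ψ, hψ, fun A => (h A).prod_fiberwise fun n => ?_⟩
    simpa only [inner_compress] using
      hasSum_vectorFunctional q (compress A (p.1.1 n) (p.2.1 n))
  | zero => exact ⟨0, zero_mem _, fun A => by simp⟩
  | add φ φ' _ _ h₁ h₂ =>
    obtain ⟨ψ, hψ, h⟩ := h₁
    obtain ⟨ψ', hψ', h'⟩ := h₂
    exact ⟨ψ + ψ', add_mem hψ hψ', fun A => (h A).add (h' A)⟩
  | smul c φ _ h =>
    obtain ⟨ψ, hψ, h⟩ := h
    exact ⟨c • ψ, Submodule.smul_mem _ c hψ, fun A => (h A).const_smul c⟩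

/-- The slice map of a normal functional is normal. -/
theorem isNormalMap_sliceMap {ρ : (H₂ →L[ℂ] H₂) →L[ℂ] ℂ}
    (hρ : (ρ : (H₂ →L[ℂ] H₂) →ₗ[ℂ] ℂ) ∈ Submodule.span ℂ (Set.range (vectorFunctional (H := H₂)))) :
    IsNormalMap (sliceMap (H₁ := H₁) ρ) := by
  rw [isNormalMap_iff]
  intro p
  obtain ⟨ψ, hψ, h⟩ := exists_hasSum_compress p hρ
  convert hψ
  ext A
  refine (hasSum_vectorFunctional p (sliceMap ρ A)).unique ?_
  simp only [inner_sliceMap]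
  exact h A

theorem IsNormalMap.inner_mem_span {H K : Type*} [NormedAddCommGroup H] [InnerProductSpace ℂ H]
    [NormedAddCommGroup K] [InnerProductSpace ℂ K]
    {E : (H →L[ℂ] H) →ₗ[ℂ] (K →L[ℂ] K)} (hE : IsNormalMap E) (x y : K) :
    ∃ φ ∈ Submodule.span ℂ (Set.range (vectorFunctional (H := H))),
      ∀ A, φ A = inner ℂ x (E A y) :=
  ⟨_, (isNormalMap_iff E).1 hE
    (⟨_, summable_norm_sq_single x⟩, ⟨_, summable_norm_sq_single y⟩),
    fun A => vectorFunctional_single x y (E A)⟩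

theorem IsNormalMap.continuousOn_wot {H K : Type*} [NormedAddCommGroup H] [InnerProductSpace ℂ H]
    [CompleteSpace H] [NormedAddCommGroup K] [InnerProductSpace ℂ K] [CompleteSpace K]
    {E : (H →L[ℂ] H) →ₗ[ℂ] (K →L[ℂ] K)} (hE : IsNormalMap E) (r : ℝ) :
    ContinuousOn (fun A : H →WOT[ℂ] H => ContinuousLinearMapWOT.ofCLM (E A.toCLM))
      {A | ‖A.toCLM‖ ≤ r} := by
  refine ContinuousLinearMapWOT.continuousOn_iff.2 fun x y => ?_
  obtain ⟨φ, hφ, h⟩ := hE.inner_mem_span y x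
  exact (continuousOn_wot_of_mem_span hφ r).congr fun A _ => (h A.toCLM).symm

omit [CompleteSpace H₁] [CompleteSpace H₂] in
/-- A normal functional that vanishes on all `A ⊗ B` is zero. -/
theorem eq_zero_of_opTensor_eq_zero {φ : (HilbertTensor H₁ H₂ →L[ℂ] HilbertTensor H₁ H₂) →ₗ[ℂ] ℂ}
    (hφ : φ ∈ Submodule.span ℂ (Set.range (vectorFunctional (H := HilbertTensor H₁ H₂))))
    (h : ∀ A B, φ (opTensor A B) = 0) : φ = 0 := by
  obtain ⟨C, hC⟩ := exists_bound_of_mem_span hφ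
  have hc : Continuous φ := AddMonoidHomClass.continuous_of_bound φ C hC
  -- For elementary tensors ξ and η the rank-one operator is itself a tensor of rank-one operators;
  -- norm continuity of φ extends the vanishing to all ξ and η.
  have hr ξ η : φ (InnerProductSpace.rankOne ℂ ξ η) = 0 := by
    refine HilbertTensor.induction_on
      (p := fun ξ => φ (InnerProductSpace.rankOne ℂ ξ η) = 0) ξ
      (isClosed_eq (by fun_prop) (by fun_prop)) (fun x u => ?_) fun ξ ξ' h₁ h₂ => ?_
    · refine HilbertTensor.induction_on
        (p := fun η => φ (InnerProductSpace.rankOne ℂ (ket x u) η) = 0) η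
        (isClosed_eq (by fun_prop) (by fun_prop)) (fun y v => ?_) fun η η' h₁ h₂ => ?_
      · rw [← h (InnerProductSpace.rankOne ℂ x y) (InnerProductSpace.rankOne ℂ u v)]
        congr 1
        refine HilbertTensor.hom_ext fun z w => ?_
        rw [opTensor_ket]
        simp [inner_ket_ket, ket_smul, smul_smul, mul_comm]
      · rw [map_add, map_add, h₁, h₂, add_zero]
    · rw [map_add, add_apply, map_add, h₁, h₂, add_zero]
  ext A
  obtain ⟨w, b, -⟩ := exists_hilbertBasis ℂ (HilbertTensor H₁ H₂)
  have := hasSum_rankOne_of_mem_span b hφ A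
  simp only [hr] at this
  exact this.unique hasSum_zero

omit [CompleteSpace H₁] [CompleteSpace H₂] in
theorem IsNormalMap.ext_opTensor
    {E F : (HilbertTensor H₁ H₂ →L[ℂ] HilbertTensor H₁ H₂) →ₗ[ℂ] (H₁ →L[ℂ] H₁)}
    (hE : IsNormalMap E) (hF : IsNormalMap F)
    (h : ∀ A B, E (opTensor A B) = F (opTensor A B)) : E = F := by
  ext A y
  refine ext_inner_left ℂ fun x => ?_
  obtain ⟨φ, hφ, h₁⟩ := hE.inner_mem_span x y
  obtain ⟨ψ, hψ, h₂⟩ := hF.inner_mem_span x y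
  have := eq_zero_of_opTensor_eq_zero (sub_mem hφ hψ) fun A B => by
    rw [LinearMap.sub_apply, h₁, h₂, h, sub_self]
  rw [← h₁, ← h₂, sub_eq_zero.1 this]

end Slice

/-! ### Contractivity of states and finite-dimensional cutoffs -/

section State

/-- Cauchy–Schwarz in the GNS space: |f(a)|² ≤ f(1) f(a*a) ≤ ‖a‖². -/
theorem norm_apply_le_of_map_one {A : Type*} [CStarAlgebra A] [PartialOrder A] [StarOrderedRing A]
    (f : A →ₚ[ℂ] ℂ) (h1 : f 1 = 1) (a : A) : ‖f a‖ ≤ ‖a‖ := by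
  have h := norm_inner_le_norm (𝕜 := ℂ) (f.toPreGNS 1) (f.toPreGNS a)
  have hone : ‖f.toPreGNS 1‖ = 1 := by simp [f.preGNS_norm_def, h1]
  rw [f.preGNS_inner_def, hone, one_mul, f.ofPreGNS_toPreGNS, f.ofPreGNS_toPreGNS, star_one,
    one_mul] at h
  refine h.trans (abs_le_of_sq_le_sq' ?_ (norm_nonneg a)).2
  have hle : f (star a * a) ≤ f (algebraMap ℝ A (‖a‖ ^ 2)) :=
    OrderHomClass.mono f CStarAlgebra.star_mul_le_algebraMap_norm_sq
  rw [Algebra.algebraMap_eq_smul_one, ← Complex.coe_smul, map_smul, h1] at hle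
  have := f.preGNS_norm_sq (f.toPreGNS a)
  rw [f.ofPreGNS_toPreGNS] at this
  rw [← this] at hle
  rw [smul_eq_mul, mul_one] at hle
  exact_mod_cast hle

variable {H : Type*} [NormedAddCommGroup H] [InnerProductSpace ℂ H]

theorem IsNormalState.norm_apply_le [CompleteSpace H] {ρ : (H →L[ℂ] H) →L[ℂ] ℂ}
    (hρ : IsNormalState ρ) (A : H →L[ℂ] H) : ‖ρ A‖ ≤ ‖A‖ :=
  norm_apply_le_of_map_one (PositiveLinearMap.mk₀ (ρ : (H →L[ℂ] H) →ₗ[ℂ] ℂ) fun A hA =>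
    hρ.nonneg A ((ContinuousLinearMap.nonneg_iff_isPositive A).1 hA)) hρ.map_one A

theorem IsNormalState.mem_span {ρ : (H →L[ℂ] H) →L[ℂ] ℂ} (hρ : IsNormalState ρ) :
    (ρ : (H →L[ℂ] H) →ₗ[ℂ] ℂ) ∈ Submodule.span ℂ (Set.range (vectorFunctional (H := H))) :=
  (continuous_sigmaWeak_iff _).1 hρ.normal

/-- The orthogonal projection onto the span of a finite set of vectors. -/
noncomputable def spanProjection (s : Finset H) : H →L[ℂ] H :=
  (Submodule.span ℂ (s : Set H)).starProjection

theorem adjoint_spanProjection [CompleteSpace H] (s : Finset H) :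
    ContinuousLinearMap.adjoint (spanProjection s) = spanProjection s :=
  (isSelfAdjoint_starProjection _).adjoint_eq

theorem norm_spanProjection_le (s : Finset H) : ‖spanProjection s‖ ≤ 1 :=
  Submodule.starProjection_norm_le _

theorem eventually_spanProjection_apply (x : H) : ∀ᶠ s in atTop, spanProjection s x = x := by
  filter_upwards [eventually_ge_atTop {x}] with s hs
  refine Submodule.starProjection_eq_self_iff.2 (Submodule.subset_span ?_)
  simpa using hs

/-- The projections converge only strongly, yet the estimate is uniform in `B`: the self-adjoint 1 -
P moves onto the fixed vectors xₙ, and dominated convergence applies to ∑ₙ ‖xₙ - P xₙ‖‖yₙ‖. -/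
theorem eventually_norm_sub_spanProjection_mul_le [CompleteSpace H] {φ : (H →L[ℂ] H) →ₗ[ℂ] ℂ}
    (hφ : φ ∈ Submodule.span ℂ (Set.range (vectorFunctional (H := H)))) {δ : ℝ} (hδ : 0 < δ) :
    ∀ᶠ s in atTop, ∀ B, ‖φ B - φ (spanProjection s * B)‖ ≤ δ * ‖B‖ := by
  induction hφ using Submodule.span_induction generalizing δ with
  | mem φ h =>
    obtain ⟨p, rfl⟩ := h
    have hs := summable_norm_mul_norm p.1.2 p.2.2
    have hb (s : Finset H) n : ‖p.1.1 n - spanProjection s (p.1.1 n)‖ ≤ 2 * ‖p.1.1 n‖ := by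
      refine (norm_sub_le _ _).trans ?_
      have := (spanProjection s).le_of_opNorm_le (norm_spanProjection_le s) (p.1.1 n)
      linarith
    have ht : Tendsto (fun s => ∑' n, ‖p.1.1 n - spanProjection s (p.1.1 n)‖ * ‖p.2.1 n‖) atTop
        (𝓝 (∑' _ : ℕ, (0 : ℝ))) := by
      refine tendsto_tsum_of_dominated_convergence (hs.mul_left 2) (fun n => ?_)
        (Eventually.of_forall fun s n => ?_)
      · refine tendsto_const_nhds.congr' ?_
        filter_upwards [eventually_spanProjection_apply (p.1.1 n)] with s h
        rw [h, sub_self, norm_zero, zero_mul]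
      · rw [Real.norm_of_nonneg (by positivity), ← mul_assoc]
        gcongr
        exact hb s n
    rw [tsum_zero] at ht
    filter_upwards [ht.eventually_lt_const hδ] with s h B
    have hsum : Summable fun n => ‖p.1.1 n - spanProjection s (p.1.1 n)‖ * ‖p.2.1 n‖ := by
      refine Summable.of_nonneg_of_le (fun n => by positivity) (fun n => ?_) (hs.mul_left 2)
      rw [← mul_assoc]
      gcongr
      exact hb s n
    have h₁ := (hasSum_vectorFunctional p B).sub (hasSum_vectorFunctional p (spanProjection s * B))
    refine (h₁.norm_le_of_bounded (hsum.mul_left ‖B‖).hasSum fun n => ?_).trans ?_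
    · rw [mul_apply_eq_comp, ← ContinuousLinearMap.adjoint_inner_left (spanProjection s),
        adjoint_spanProjection, ← inner_sub_left]
      exact norm_inner_apply_le _ _ _
    · rw [tsum_mul_left, mul_comm]
      gcongr
  | zero => exact Eventually.of_forall fun s B => by simp; positivity
  | add φ ψ _ _ h₁ h₂ =>
    filter_upwards [h₁ (half_pos hδ), h₂ (half_pos hδ)] with s h h' B
    calc _ = ‖(φ B - φ (spanProjection s * B)) + (ψ B - ψ (spanProjection s * B))‖ := by
          simp only [LinearMap.add_apply]; congr 1; ring
      _ ≤ _ := (norm_add_le _ _).trans (by linarith [h B, h' B])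
  | smul c φ _ h =>
    filter_upwards [h (δ := δ / (‖c‖ + 1)) (by positivity)] with s h B
    rw [LinearMap.smul_apply, LinearMap.smul_apply, ← smul_sub, norm_smul]
    calc _ ≤ (‖c‖ + 1) * (δ / (‖c‖ + 1) * ‖B‖) := by
          gcongr
          · linarith
          · exact h B
      _ = _ := by field_simp

end State

/-! ### Averaging over signed shifts -/

section Twirl

variable {H : Type*} [NormedAddCommGroup H] [InnerProductSpace ℂ H]
  {ι : Type*} [Fintype ι] {F : Submodule ℂ H}

/-- The normalized trace on the operators on a finite-dimensional subspace. -/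
noncomputable def normalizedTrace (b : OrthonormalBasis ι ℂ F) : (H →L[ℂ] H) →L[ℂ] ℂ :=
  LinearMap.mkContinuous
    { toFun := fun B => (Fintype.card ι : ℂ)⁻¹ * ∑ i, inner ℂ (b i : H) (B (b i))
      map_add' := fun A B => by simp [Finset.sum_add_distrib, mul_add]
      map_smul' := fun c A => by simp [← Finset.mul_sum, mul_left_comm] }
    1 fun B => by
      have h : ‖∑ i, inner ℂ (b i : H) (B (b i))‖ ≤ Fintype.card ι * ‖B‖ := by
        refine (norm_sum_le_of_le (f := fun i => inner ℂ (b i : H) (B (b i))) Finset.univ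
          (n := fun _ => ‖B‖) fun i _ => ?_).trans (by simp)
        have hb : ‖(b i : H)‖ = 1 := b.orthonormal.1 i
        simpa [hb] using norm_inner_apply_le B (b i : H) (b i)
      rw [LinearMap.coe_mk, AddHom.coe_mk, norm_mul, norm_inv, Complex.norm_natCast, one_mul]
      -- For an empty basis the inverse of 0 is 0, so the functional vanishes.
      rcases Nat.eq_zero_or_pos (Fintype.card ι) with h0 | h0
      · simp [h0]
      · rwa [inv_mul_le_iff₀ (by positivity)]

theorem normalizedTrace_apply (b : OrthonormalBasis ι ℂ F) (B : H →L[ℂ] H) :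
    normalizedTrace b B = (Fintype.card ι : ℂ)⁻¹ * ∑ i, inner ℂ (b i : H) (B (b i)) := rfl

theorem norm_normalizedTrace_apply_le (b : OrthonormalBasis ι ℂ F) (B : H →L[ℂ] H) :
    ‖normalizedTrace b B‖ ≤ ‖B‖ := by
  simpa using (normalizedTrace b).le_of_opNorm_le (LinearMap.mkContinuous_norm_le _ zero_le_one _) B

/-- For i ≠ j, flipping the sign at i permutes the sign vectors and negates the summand. -/
theorem sum_sign_mul_sign [DecidableEq ι] (i j : ι) :
    ∑ σ : ι → ℤˣ, (((σ i : ℤ) : ℂ) * ((σ j : ℤ) : ℂ)) =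
      if i = j then (Fintype.card (ι → ℤˣ) : ℂ) else 0 := by
  split_ifs with hij
  · subst hij
    rw [Finset.sum_congr rfl fun σ _ => show _ = (1 : ℂ) by
      rw [← Int.cast_mul, ← Units.val_mul, Int.units_mul_self]; simp]
    simp
  · have h := Equiv.sum_comp (Equiv.mulLeft (Function.update (1 : ι → ℤˣ) i (-1)))
      fun σ : ι → ℤˣ => (((σ i : ℤ) : ℂ) * ((σ j : ℤ) : ℂ))
    simp only [Equiv.coe_mulLeft, Pi.mul_apply, Function.update_self,
      Function.update_of_ne (Ne.symm hij), Pi.one_apply, one_mul, neg_mul, Units.val_neg,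
      Int.cast_neg, Finset.sum_neg_distrib] at h
    exact self_eq_neg.1 h.symm

variable [AddCommGroup ι]

/-- The partial isometry `bᵢ ↦ σᵢ bᵢ₊ₖ` that vanishes on the orthogonal complement. -/
noncomputable def signedShift (b : OrthonormalBasis ι ℂ F) (q : (ι → ℤˣ) × ι) : H →L[ℂ] H :=
  ∑ i, ((q.1 i : ℤ) : ℂ) • InnerProductSpace.rankOne ℂ (b (i + q.2) : H) (b i : H)

variable [CompleteSpace H]

theorem adjoint_signedShift_mul_mul (b : OrthonormalBasis ι ℂ F) (q : (ι → ℤˣ) × ι)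
    (B : H →L[ℂ] H) :
    ContinuousLinearMap.adjoint (signedShift b q) * B * signedShift b q =
      ∑ i, ∑ j, (((q.1 i : ℤ) : ℂ) * ((q.1 j : ℤ) : ℂ)) •
        inner ℂ (b (i + q.2) : H) (B (b (j + q.2))) •
          InnerProductSpace.rankOne ℂ (b i : H) (b j : H) := by
  ext v
  refine ext_inner_left ℂ fun u => ?_
  rw [mul_apply_eq_comp, mul_apply_eq_comp, ContinuousLinearMap.adjoint_inner_right]
  simp only [signedShift, sum_apply, smul_apply, InnerProductSpace.rankOne_apply, map_sum, map_smul,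
    sum_inner, inner_sum, inner_smul_left, inner_smul_right, map_intCast, inner_conj_symm,
    Finset.mul_sum]
  rw [Finset.sum_comm]
  refine Finset.sum_congr rfl fun i _ => Finset.sum_congr rfl fun j _ => ?_
  ring

variable [F.HasOrthogonalProjection]

theorem adjoint_signedShift_mul_self (b : OrthonormalBasis ι ℂ F) (q : (ι → ℤˣ) × ι) :
    ContinuousLinearMap.adjoint (signedShift b q) * signedShift b q = F.starProjection := by
  classical
  have h := adjoint_signedShift_mul_mul b q 1
  rw [mul_one] at h
  rw [h, b.starProjection_eq_sum_rankOne]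
  refine Finset.sum_congr rfl fun i _ => ?_
  have hb i j : inner ℂ (b i : H) (b j : H) = if i = j then 1 else 0 :=
    orthonormal_iff_ite.1 b.orthonormal i j
  rw [Finset.sum_eq_single i]
  · rw [one_apply_eq_self, hb, if_pos rfl, one_smul, ← Int.cast_mul, ← Units.val_mul, Int.units_mul_self]
    simp
  · intro j _ hj
    rw [one_apply_eq_self, hb, if_neg (by simpa using hj.symm), zero_smul, smul_zero]
  · simp

theorem norm_signedShift_le (b : OrthonormalBasis ι ℂ F) (q : (ι → ℤˣ) × ι) :
    ‖signedShift b q‖ ≤ 1 := by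
  have h := CStarRing.norm_star_mul_self (x := signedShift b q)
  rw [ContinuousLinearMap.star_eq_adjoint, adjoint_signedShift_mul_self] at h
  have := F.starProjection_norm_le
  nlinarith [norm_nonneg (signedShift b q)]

/-- Averaging over the signed shifts of an orthonormal basis yields the normalized trace. -/
theorem sum_adjoint_signedShift_mul_mul [DecidableEq ι] (b : OrthonormalBasis ι ℂ F)
    (B : H →L[ℂ] H) :
    ∑ q, ContinuousLinearMap.adjoint (signedShift b q) * B * signedShift b q =
      (Fintype.card ((ι → ℤˣ) × ι) : ℂ) • normalizedTrace b B • F.starProjection := by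
  have hι : (Fintype.card ι : ℂ) ≠ 0 := by simp
  calc _ = ∑ k, ∑ i, ∑ j, (∑ σ : ι → ℤˣ, (((σ i : ℤ) : ℂ) * ((σ j : ℤ) : ℂ))) •
        inner ℂ (b (i + k) : H) (B (b (j + k))) •
          InnerProductSpace.rankOne ℂ (b i : H) (b j : H) := by
        simp only [adjoint_signedShift_mul_mul]
        rw [Fintype.sum_prod_type_right]
        refine Finset.sum_congr rfl fun k _ => ?_
        rw [Finset.sum_comm]
        refine Finset.sum_congr rfl fun i _ => ?_
        rw [Finset.sum_comm]
        refine Finset.sum_congr rfl fun j _ => ?_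
        rw [Finset.sum_smul]
    -- The average over signs removes the off-diagonal entries.
    _ = (Fintype.card (ι → ℤˣ) : ℂ) • ∑ i, (∑ k, inner ℂ (b (i + k) : H) (B (b (i + k)))) •
          InnerProductSpace.rankOne ℂ (b i : H) (b i : H) := by
        simp only [sum_sign_mul_sign, ite_smul, zero_smul, Finset.sum_ite_eq, Finset.mem_univ,
          if_true]
        rw [Finset.sum_comm, Finset.smul_sum]
        refine Finset.sum_congr rfl fun i _ => ?_
        rw [Finset.sum_smul, Finset.smul_sum]
    _ = _ := by
        -- The shifts carry each diagonal position through the whole basis, so every diagonal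
        -- coefficient becomes the full trace.
        have hs i : ∑ k, inner ℂ (b (i + k) : H) (B (b (i + k))) =
            ∑ k, inner ℂ (b k : H) (B (b k)) :=
          Equiv.sum_comp (Equiv.addLeft i) fun k => inner ℂ (b k : H) (B (b k))
        simp only [hs]
        rw [← Finset.smul_sum, b.starProjection_eq_sum_rankOne, smul_smul, smul_smul,
          normalizedTrace_apply, Fintype.card_prod]
        congr 1
        push_cast
        field_simp

end Twirl

/-! ### The approximation bound -/

section Approximation

theorem opNorm_smul {E : Type*} [NormedAddCommGroup E] [NormedSpace ℂ E] (c : ℂ) (T : E →L[ℂ] E) :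
    ‖c • T‖ = ‖c‖ * ‖T‖ :=
  norm_smul c T

variable {H₁ H₂ : Type*}
  [NormedAddCommGroup H₁] [InnerProductSpace ℂ H₁]
  [NormedAddCommGroup H₂] [InnerProductSpace ℂ H₂]

/-- An algebraic tensor involves finitely many vectors of H₂, so equality holds exactly once their
span is included. -/
theorem eventually_opTensor_spanProjection_apply (t : H₁ ⊗[ℂ] H₂) :
    ∀ᶠ s in atTop, opTensor (1 : H₁ →L[ℂ] H₁) (spanProjection s) (t : HilbertTensor H₁ H₂) = t := by
  induction t using TensorProduct.induction_on with
  | zero => exact Eventually.of_forall fun s => by rw [UniformSpace.Completion.coe_zero, map_zero]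
  | tmul x u =>
    filter_upwards [eventually_spanProjection_apply u] with s hs
    rw [← ket_apply, opTensor_ket, hs, one_apply_eq_self]
  | add t t' h h' =>
    filter_upwards [h, h'] with s hs hs'
    rw [UniformSpace.Completion.coe_add, map_add, hs, hs']

theorem opTensor_one_one : opTensor (1 : H₁ →L[ℂ] H₁) (1 : H₂ →L[ℂ] H₂) = 1 :=
  HilbertTensor.hom_ext fun x u => by simp [opTensor_ket]

theorem opTensor_zero_left (B : H₂ →L[ℂ] H₂) : opTensor (0 : H₁ →L[ℂ] H₁) B = 0 :=
  HilbertTensor.hom_ext fun x u => by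
    rw [opTensor_ket, zero_apply, ← zero_smul ℂ (0 : H₁), ket_smul, zero_smul, zero_apply,
      zero_apply]

theorem opTensor_zero_right (A : H₁ →L[ℂ] H₁) : opTensor A (0 : H₂ →L[ℂ] H₂) = 0 :=
  HilbertTensor.hom_ext fun x u => by simp [opTensor_ket]

variable [CompleteSpace H₂]

theorem compress_add (A B : HilbertTensor H₁ H₂ →L[ℂ] HilbertTensor H₁ H₂) (x y : H₁) :
    compress (A + B) x y = compress A x y + compress B x y := by
  simp [compress, ContinuousLinearMap.add_comp, ContinuousLinearMap.comp_add]

theorem compress_sum {κ : Type*} (s : Finset κ)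
    (A : κ → HilbertTensor H₁ H₂ →L[ℂ] HilbertTensor H₁ H₂) (x y : H₁) :
    compress (∑ q ∈ s, A q) x y = ∑ q ∈ s, compress (A q) x y :=
  map_sum (AddMonoidHom.mk' (fun A => compress A x y) fun A B => compress_add A B x y) A s

theorem compress_smul (c : ℂ) (A : HilbertTensor H₁ H₂ →L[ℂ] HilbertTensor H₁ H₂) (x y : H₁) :
    compress (c • A) x y = c • compress A x y := by
  simp [compress, ContinuousLinearMap.smul_comp]

theorem ext_compress {S T : HilbertTensor H₁ H₂ →L[ℂ] HilbertTensor H₁ H₂}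
    (h : ∀ x y, compress S x y = compress T x y) : S = T := by
  refine HilbertTensor.hom_ext fun y v => ext_inner_left ℂ fun ζ => ?_
  refine HilbertTensor.induction_on
    (p := fun ζ => inner ℂ ζ (S (ket y v)) = inner ℂ ζ (T (ket y v))) ζ
    (isClosed_eq (by fun_prop) (by fun_prop)) (fun x u => ?_) fun ζ ζ' h₁ h₂ => ?_
  · rw [← inner_compress, ← inner_compress, h]
  · rw [inner_add_left, inner_add_left, h₁, h₂]

variable [CompleteSpace H₁]

section

variable {F : Submodule ℂ H₂} [F.HasOrthogonalProjection]

theorem sum_opTensor_signedShift {ι : Type*} [Fintype ι] [DecidableEq ι] [AddCommGroup ι]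
    (b : OrthonormalBasis ι ℂ F) (A : HilbertTensor H₁ H₂ →L[ℂ] HilbertTensor H₁ H₂) :
    ∑ q, opTensor 1 (ContinuousLinearMap.adjoint (signedShift b q)) * A *
        opTensor 1 (signedShift b q) =
      (Fintype.card ((ι → ℤˣ) × ι) : ℂ) •
        opTensor (sliceMap (normalizedTrace b) A) F.starProjection := by
  refine ext_compress fun x y => ?_
  rw [compress_sum, compress_smul, compress_opTensor, inner_sliceMap,
    ← sum_adjoint_signedShift_mul_mul]
  refine Finset.sum_congr rfl fun q _ => ?_
  rw [compress_mul_mul, ← ContinuousLinearMap.star_eq_adjoint (1 : H₁ →L[ℂ] H₁), star_one,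
    one_apply_eq_self, one_apply_eq_self]

/-- Each averaged term differs from (1 ⊗ P)A by (1 ⊗ U*)[A, 1 ⊗ U], of norm at most c because U*U =
P and ‖U‖ ≤ 1. -/
theorem norm_opTensor_normalizedTrace_sub_le {ι : Type*} [Fintype ι] [AddCommGroup ι]
    (b : OrthonormalBasis ι ℂ F) {A : HilbertTensor H₁ H₂ →L[ℂ] HilbertTensor H₁ H₂} {c : ℝ}
    (hc : 0 ≤ c) (hA : ∀ B : H₂ →L[ℂ] H₂, ‖A * opTensor 1 B - opTensor 1 B * A‖ ≤ c * ‖B‖) :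
    ‖opTensor (sliceMap (normalizedTrace b) A) F.starProjection -
      opTensor 1 F.starProjection * A‖ ≤ c := by
  classical
  have hone : ‖(1 : H₁ →L[ℂ] H₁)‖ ≤ 1 := ContinuousLinearMap.norm_id_le
  have hpos : (0 : ℝ) < Fintype.card ((ι → ℤˣ) × ι) := by exact_mod_cast Fintype.card_pos
  have hq q : ‖opTensor 1 (ContinuousLinearMap.adjoint (signedShift b q)) * A *
      opTensor 1 (signedShift b q) - opTensor 1 F.starProjection * A‖ ≤ c := by
    have h : ‖A * opTensor 1 (signedShift b q) - opTensor 1 (signedShift b q) * A‖ ≤ c := 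
      (hA _).trans (mul_le_of_le_one_right hc (norm_signedShift_le b q))
    have hU : ‖opTensor (1 : H₁ →L[ℂ] H₁) (ContinuousLinearMap.adjoint (signedShift b q))‖ ≤ 1 := by
      refine (norm_opTensor_le _ _).trans (mul_le_one₀ hone (norm_nonneg _) ?_)
      rw [LinearIsometryEquiv.norm_map]
      exact norm_signedShift_le b q
    rw [← adjoint_signedShift_mul_self b q, ← one_mul (1 : H₁ →L[ℂ] H₁), ← opTensor_mul, one_mul,
      mul_assoc, mul_assoc, ← mul_sub]
    exact (ContinuousLinearMap.opNorm_comp_le _ _).trans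
      ((mul_le_of_le_one_left (norm_nonneg _) hU).trans h)
  set X := opTensor (sliceMap (normalizedTrace b) A) F.starProjection -
    opTensor 1 F.starProjection * A with hX
  have hsum : ‖(Fintype.card ((ι → ℤˣ) × ι) : ℂ) • X‖ ≤ Fintype.card ((ι → ℤˣ) × ι) * c := by
    rw [hX, smul_sub, ← sum_opTensor_signedShift, Nat.cast_smul_eq_nsmul, ← Finset.card_univ,
      ← Finset.sum_const, ← Finset.sum_sub_distrib]
    refine (norm_sum_le_of_le (E := HilbertTensor H₁ H₂ →L[ℂ] HilbertTensor H₁ H₂) Finset.univ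
      fun q _ => hq q).trans ?_
    rw [Finset.sum_const, nsmul_eq_mul]
  rw [opNorm_smul, Complex.norm_natCast] at hsum
  exact le_of_mul_le_mul_left hsum hpos

end

/-- An operator that almost commutes with `B(H₂)` is close, on a finite-dimensional part of `H₂`,
to an operator on `H₁`. -/
theorem exists_norm_opTensor_spanProjection_sub_le
    {A : HilbertTensor H₁ H₂ →L[ℂ] HilbertTensor H₁ H₂} {c : ℝ} (hc : 0 ≤ c)
    (hA : ∀ B : H₂ →L[ℂ] H₂, ‖A * opTensor 1 B - opTensor 1 B * A‖ ≤ c * ‖B‖) (s : Finset H₂) :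
    ∃ A' : H₁ →L[ℂ] H₁, ‖A'‖ ≤ ‖A‖ ∧
      ‖opTensor A' (spanProjection s) - opTensor 1 (spanProjection s) * A‖ ≤ c := by
  let b := stdOrthonormalBasis ℂ (Submodule.span ℂ (s : Set H₂))
  -- The shifts use the cyclic group on `Fin n`, which requires n ≠ 0.
  rcases Nat.eq_zero_or_pos (Module.finrank ℂ (Submodule.span ℂ (s : Set H₂))) with h0 | h0
  · refine ⟨0, by rw [norm_zero]; exact norm_nonneg A, ?_⟩
    have : spanProjection s = 0 := by
      simp [spanProjection, Submodule.finrank_eq_zero.1 h0]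
    rw [this, opTensor_zero_left, opTensor_zero_right, zero_mul, sub_zero]
    exact ContinuousLinearMap.opNorm_zero.trans_le hc
  · have : NeZero (Module.finrank ℂ (Submodule.span ℂ (s : Set H₂))) := ⟨h0.ne'⟩
    refine ⟨sliceMap (normalizedTrace b) A, ?_, norm_opTensor_normalizedTrace_sub_le b hc hA⟩
    simpa using norm_sliceMap_le_of_bound (normalizedTrace b) zero_le_one
      (by simpa using norm_normalizedTrace_apply_le b) A

theorem norm_opTensor_sliceMap_sub_le {ρ : (H₂ →L[ℂ] H₂) →L[ℂ] ℂ} (hρ : IsNormalState ρ)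
    {A : HilbertTensor H₁ H₂ →L[ℂ] HilbertTensor H₁ H₂} {c : ℝ} (hc : 0 ≤ c)
    (hA : ∀ B : H₂ →L[ℂ] H₂, ‖A * opTensor 1 B - opTensor 1 B * A‖ ≤ c * ‖B‖) :
    ‖opTensor (sliceMap ρ A) 1 - A‖ ≤ 2 * c := by
  have hone : ‖(1 : H₂ →L[ℂ] H₂)‖ ≤ 1 := ContinuousLinearMap.norm_id_le
  have slice_le X : ‖sliceMap (H₁ := H₁) ρ X‖ ≤ ‖X‖ := by
    simpa using norm_sliceMap_le_of_bound ρ zero_le_one (by simpa using hρ.norm_apply_le) X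
  refine le_of_forall_pos_le_add fun e he => ?_
  -- Two errors of size δ‖A‖ occur below: cutting off `A` by P, and replacing ρ(P) by 1.
  obtain ⟨δ, hδ, hδe⟩ : ∃ δ, 0 < δ ∧ 2 * δ * ‖A‖ ≤ e :=
    ⟨e / (2 * ‖A‖ + 1), by positivity, by
      rw [mul_div_assoc', div_mul_eq_mul_div, div_le_iff₀ (by positivity)]
      nlinarith [norm_nonneg A]⟩
  have hρs := eventually_norm_sub_spanProjection_mul_le hρ.mem_span hδ
  refine norm_le_of_norm_inner_le (by positivity) fun ξ η => ?_
  -- Only the left vector must be algebraic: P then depends on it alone, and the bound on the right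
  -- vector is uniform.
  refine UniformSpace.Completion.induction_on ξ (isClosed_le (by fun_prop) (by fun_prop))
    fun t => ?_
  obtain ⟨s, hs, ht⟩ := (hρs.and (eventually_opTensor_spanProjection_apply (H₁ := H₁) t)).exists
  obtain ⟨A', hA', hc'⟩ := exists_norm_opTensor_spanProjection_sub_le hc hA s
  set P := spanProjection s
  have hslice : ‖sliceMap ρ A - A'‖ ≤ c + e := by
    have h₁ : ‖sliceMap ρ A - sliceMap ρ (opTensor 1 P * A)‖ ≤ δ * ‖A‖ := by
      refine norm_le_of_norm_inner_le (by positivity) fun x y => ?_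
      have h := compress_mul_mul A 1 1 P 1 x y
      rw [opTensor_one_one, mul_one, mul_one, ← ContinuousLinearMap.star_eq_adjoint, star_one,
        one_apply_eq_self, one_apply_eq_self] at h
      rw [sub_apply, inner_sub_right, inner_sliceMap, inner_sliceMap, h, mul_assoc]
      exact (hs _).trans (by gcongr; exact norm_compress_le A x y)
    have h₂ : ‖sliceMap ρ (opTensor 1 P * A) - ρ P • A'‖ ≤ c := by
      rw [← sliceMap_opTensor, ← map_sub]
      exact (slice_le _).trans ((norm_sub_rev (opTensor 1 P * A) (opTensor A' P)).trans_le hc')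
    have h₃ : ‖ρ P • A' - A'‖ ≤ δ * ‖A‖ := by
      have h := hs 1
      rw [mul_one, ContinuousLinearMap.coe_coe, hρ.map_one, norm_sub_rev] at h
      calc ‖ρ P • A' - A'‖ = ‖ρ P - 1‖ * ‖A'‖ := by rw [← norm_smul, sub_smul, one_smul]
        _ ≤ δ * ‖A‖ := by
          gcongr
          exact h.trans (mul_le_of_le_one_right hδ.le hone)
    calc ‖sliceMap ρ A - A'‖
        ≤ ‖sliceMap ρ A - sliceMap ρ (opTensor 1 P * A)‖ +
          ‖sliceMap ρ (opTensor 1 P * A) - ρ P • A'‖ + ‖ρ P • A' - A'‖ := by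
          refine le_trans (le_of_eq ?_) (norm_add₃_le ..)
          congr 1
          abel
      _ ≤ c + e := by linarith
  -- The first term costs c + e by `hslice`, the second c by the choice of A'; hence the factor 2.
  have hmid : opTensor 1 P * (opTensor (sliceMap ρ A) 1 - A) =
      opTensor (sliceMap ρ A - A') P + (opTensor A' P - opTensor 1 P * A) := by
    rw [mul_sub, opTensor_mul, one_mul, mul_one, opTensor_sub_left]
    abel
  have hnorm : ‖opTensor 1 P * (opTensor (sliceMap ρ A) 1 - A)‖ ≤ 2 * c + e := by
    rw [hmid]
    refine (ContinuousLinearMap.opNorm_add_le _ _).trans ?_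
    have := (norm_opTensor_le (sliceMap ρ A - A') P).trans
      (mul_le_of_le_one_right (norm_nonneg _) (norm_spanProjection_le s))
    linarith
  have hadj : ContinuousLinearMap.adjoint (opTensor (1 : H₁ →L[ℂ] H₁) P) = opTensor 1 P := by
    rw [adjoint_opTensor, adjoint_spanProjection, ← ContinuousLinearMap.star_eq_adjoint,
      star_one]
  have hinner (ζ : HilbertTensor H₁ H₂) :
      inner ℂ (t : HilbertTensor H₁ H₂) ζ = inner ℂ (t : HilbertTensor H₁ H₂) (opTensor 1 P ζ) := by
    rw [← hadj, ContinuousLinearMap.adjoint_inner_right, ht]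
  rw [hinner, ← mul_apply_eq_comp]
  exact (norm_inner_apply_le _ _ _).trans (by gcongr)

end Approximation

theorem proposition2 {H₁ H₂ : Type*}
    [NormedAddCommGroup H₁] [InnerProductSpace ℂ H₁] [CompleteSpace H₁]
    [NormedAddCommGroup H₂] [InnerProductSpace ℂ H₂] [CompleteSpace H₂]
    (ρ : (H₂ →L[ℂ] H₂) →L[ℂ] ℂ) (hρ : IsNormalState ρ) :
    -- `E_ρ` is the normal linear map with `E_ρ (A ⊗ B) = ρ(B) A`, and the only one
    (∀ (A : H₁ →L[ℂ] H₁) (B : H₂ →L[ℂ] H₂), sliceMap ρ (opTensor A B) = ρ B • A) ∧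
    IsNormalMap (sliceMap (H₁ := H₁) ρ) ∧
    (∀ E : (HilbertTensor H₁ H₂ →L[ℂ] HilbertTensor H₁ H₂) →ₗ[ℂ] (H₁ →L[ℂ] H₁),
      IsNormalMap E → (∀ (A : H₁ →L[ℂ] H₁) (B : H₂ →L[ℂ] H₂), E (opTensor A B) = ρ B • A) →
      E = sliceMap ρ) ∧
    -- continuity for the weak operator topologies on bounded sets
    (∀ r : ℝ, ContinuousOn
      (fun A : HilbertTensor H₁ H₂ →WOT[ℂ] HilbertTensor H₁ H₂ =>
        ContinuousLinearMapWOT.ofCLM (sliceMap ρ A.toCLM))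
      {A | ‖A.toCLM‖ ≤ r}) ∧
    -- property 1
    (∀ A : H₁ →L[ℂ] H₁, sliceMap ρ (opTensor A (1 : H₂ →L[ℂ] H₂)) = A) ∧
    -- the bimodule property
    (∀ (C D : H₁ →L[ℂ] H₁) (A : HilbertTensor H₁ H₂ →L[ℂ] HilbertTensor H₁ H₂),
      sliceMap ρ (opTensor C 1 * A * opTensor D 1) = C * sliceMap ρ A * D) ∧
    -- the approximation bound
    (∀ (ε : ℝ) (A : HilbertTensor H₁ H₂ →L[ℂ] HilbertTensor H₁ H₂), 0 ≤ ε →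
      (∀ B : H₂ →L[ℂ] H₂, ‖A * opTensor 1 B - opTensor 1 B * A‖ ≤ ε * ‖A‖ * ‖B‖) →
      ‖opTensor (sliceMap ρ A) 1 - A‖ ≤ 2 * ε * ‖A‖) := by
  refine ⟨sliceMap_opTensor ρ, isNormalMap_sliceMap hρ.mem_span, fun E hE h => ?_,
    (isNormalMap_sliceMap hρ.mem_span).continuousOn_wot, fun A => ?_, sliceMap_bimodule ρ,
    fun ε A hε hA => ?_⟩
  · exact hE.ext_opTensor (isNormalMap_sliceMap hρ.mem_span) fun A B => by
      rw [h, sliceMap_opTensor]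
  · rw [sliceMap_opTensor, hρ.map_one, one_smul]
  · rw [mul_assoc]
    exact norm_opTensor_sliceMap_sub_le hρ (by positivity) hA
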